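/- Let $m\ge 4$. For $\varepsilon>0$ and $b\in\mathbb R^m$ let $D_m^\varepsilon=D_m^\varepsilon(b)\subset\mathbb R^m$ be the set of all $x$ that satisfy the $2m$ linear inequalities $$\pm\varepsilon x_k+2x_{k-1}-7x_{k-2}+7x_{k-3}-2x_{k-4}\le b_k\qquad(1\le k\le m),$$ where $x_j:=0$ for $j\le 0$. Nonempty faces of the cube $C_m=[0,1]^m$ correspond to patterns $\sigma\in\{0,1,*\}^m$: the face of $\sigma$ consists of the $x\in C_m$ with $x_k=\sigma_k$ whenever $\sigma_k\ne *$. The quad-surface $Q_m$ is the complex of all faces of $C_m$ for which the positions of the symbols $*$ are contained in a set of two cyclically successive positions $\{t,t+1\}$ (modulo $m$). To a pattern $\sigma$ we also associate the set of all $x\in D_m^\varepsilon$ for which, for every $k$ with $\sigma_k\neq *$, the $k$-th inequality with sign $+$ (if $\sigma_k=1$), respectively with sign $-$ (if $\sigma_k=0$), is an equality. We say that $D_m^\varepsilon(b)$ is a deformed cube if it is a polytope and if, by means of patterns, its nonempty faces correspond bijectively and compatibly with inclusion, in both directions, to the nonempty faces of $C_m$. In this case $Q_m^\varepsilon=Q_m^\varepsilon(b)$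 denotes the complex of those faces of $D_m^\varepsilon(b)$ that correspond to the faces in $Q_m$. Let $\pi:\mathbb R^m\to\mathbb R^4$ be the projection to the last four coordinates. **Proposition.** There is an $\varepsilon_0>0$, depending only on $m$, such that the following holds for all $0<\varepsilon<\varepsilon_0$. For $b_k=(6/\varepsilon)^{k-1}$ the set $D_m^\varepsilon(b)$ is a deformed cube. Moreover, for every $b\in\mathbb R^m$ such that $D_m^\varepsilon(b)$ is a deformed cube: 1. $\pi(D_m^\varepsilon)$ is a $4$-dimensional polytope. 2. Every face $G$ in $Q_m^\varepsilon$ is strictly preserved by $\pi$: $\pi(G)$ is a face of $\pi(D_m^\varepsilon)$, $G=D_m^\varepsilon\cap\pi^{-1}(\pi(G))$, and $\pi$ is injective on $G$. 3. $\pi$ is injective on the union $|Q_m^\varepsilon|$ of the faces in $Q_m^\varepsilon$, and it yields a polyhedral embedding of $Q_m^\varepsilon$ in $\mathbb R^4$: it restricts to a topological embedding of $|Q_m^\varepsilon|$, and the polytopes $\pi(G)$ with $G\in Q_m^\varepsilon$ form a polyhedral complex with the same dimensions, inclusions and intersections of cells as $Q_m^\varepsilon$. 4. This complex is part of the boundary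 complex of $\pi(D_m^\varepsilon)$: each $\pi(G)$ with $G\in Q_m^\varepsilon$ is a nonempty proper face of $\pi(D_m^\varepsilon)$. 5. Sending the face of $C_m$ with a given pattern to the image under $\pi$ of the face of $D_m^\varepsilon$ with the same pattern is an inclusion- and dimension-preserving isomorphism from $Q_m$ to this complex. So $Q_m$ is polyhedrally embedded in $\mathbb R^4$. -/

import Mathlib

/-! Points of real `n`-space are functions `Fin n → ℝ`. Only the linear structure and the (usual,
product) topology are used, so the choice of a norm plays no role. Coordinates are numbered from `0`,
so the coordinate `x_k` of ordinary notation is `x (k - 1)` here. -/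

section Polyhedral

variable {E F : Type*} [AddCommGroup E] [Module ℝ E] [TopologicalSpace E]
  [AddCommGroup F] [Module ℝ F] [TopologicalSpace F]

/-- A (convex) polytope: the convex hull of a finite set of points. -/
def IsPolytope (P : Set E) : Prop :=
  ∃ S : Set E, S.Finite ∧ P = convexHull ℝ S

/-- The dimension of (the affine hull of) a nonempty set. -/
noncomputable def polyDim (P : Set E) : ℕ :=
  Module.finrank ℝ (vectorSpan ℝ P)

/-- `G` is a nonempty face of `P`: the nonempty set of points of `P` at which some continuous linear
function attains its maximum over `P`. The zero function gives the improper face `P`. -/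
def IsFaceOf (P G : Set E) : Prop :=
  G.Nonempty ∧ IsExposed ℝ P G

/-- The boundary complex of `P`: the set of all nonempty proper faces of `P`. -/
def boundaryComplex (P : Set E) : Set (Set E) :=
  {G | IsFaceOf P G ∧ G ≠ P}

/-- A (finite) polyhedral complex, given by the set of its nonempty cells. -/
structure IsPolyhedralComplex (K : Set (Set E)) : Prop where
  finite : K.Finite
  nonempty : ∀ G ∈ K, G.Nonempty
  polytope : ∀ G ∈ K, IsPolytope G
  face_mem : ∀ G ∈ K, ∀ H, IsFaceOf G H → H ∈ K
  inter_face : ∀ G ∈ K, ∀ H ∈ K, (G ∩ H).Nonempty → IsFaceOf G (G ∩ H) ∧ IsFaceOf H (G ∩ H)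

/-- The family of the images of the cells of `K` under `f`. -/
def imageComplex (f : E →ₗ[ℝ] F) (K : Set (Set E)) : Set (Set F) :=
  (fun G => f '' G) '' K

/-- The linear map `f` yields a polyhedral embedding of the polyhedral complex `K`: it restricts to a
topological embedding of the underlying space of `K`, and the images of the cells of `K` form a
polyhedral complex with the same dimensions, inclusions and intersections of cells. -/
structure IsPolyhedralEmbedding (f : E →ₗ[ℝ] F) (K : Set (Set E)) : Prop where
  source : IsPolyhedralComplex K
  target : IsPolyhedralComplex (imageComplex f K)
  embedding : Topology.IsEmbedding ((⋃₀ K).domRestrict f)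
  dim_eq : ∀ G ∈ K, polyDim (f '' G) = polyDim G
  subset_iff : ∀ G ∈ K, ∀ H ∈ K, f '' G ⊆ f '' H ↔ G ⊆ H
  inter_eq : ∀ G ∈ K, ∀ H ∈ K, f '' G ∩ f '' H = f '' (G ∩ H)

/-- The face `G` of `P` is strictly preserved by the projection `f`: its image is a face of `f(P)`,
`G` is the full preimage in `P` of its image, and `f` is injective on `G`. -/
def StrictlyPreserved (f : E →ₗ[ℝ] F) (P G : Set E) : Prop :=
  IsFaceOf P G ∧ IsFaceOf (f '' P) (f '' G) ∧ P ∩ f ⁻¹' (f '' G) = G ∧ Set.InjOn f G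

end Polyhedral

section Cube

/-- Patterns in `{0, 1, *}^m`, which label the nonempty faces of the `m`-cube: `some false` stands
for `0`, `some true` for `1`, and `none` for the free symbol `*`. -/
abbrev CubePattern (m : ℕ) : Type := Fin m → Option Bool

/-- The face of the standard cube `[0,1]^m` that belongs to a pattern. -/
def cubeFace {m : ℕ} (σ : CubePattern m) : Set (Fin m → ℝ) :=
  {x | (∀ i, 0 ≤ x i ∧ x i ≤ 1) ∧ ∀ i s, σ i = some s → x i = if s then 1 else 0}

/-- The patterns whose free positions all lie in a set `{t, t + 1}` of two cyclically successive
positions (modulo `m`). -/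
def surfacePatterns (m : ℕ) : Set (CubePattern m) :=
  {σ | ∃ t : Fin m, ∀ i : Fin m, σ i = none → i = t ∨ i.val = (t.val + 1) % m}

/-- The quad-surface `Q_m`, a complex of faces of the standard cube. -/
def quadSurface (m : ℕ) : Set (Set (Fin m → ℝ)) :=
  cubeFace '' surfacePatterns m

/-- The lower triangular band matrix with `δ` on the diagonal and `2, -7, 7, -2` on the four
diagonals below it. -/
def bandMatrix (m : ℕ) (δ : ℝ) : Matrix (Fin m) (Fin m) ℝ :=
  Matrix.of fun i j =>
    if i.val = j.val then δ
    else if i.val = j.val + 1 then 2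
    else if i.val = j.val + 2 then -7
    else if i.val = j.val + 3 then 7
    else if i.val = j.val + 4 then -2
    else 0

/-- The set `D_m^ε` with right-hand side `b`: the solutions of the `2m` linear inequalities
`±ε x_k + 2 x_{k-1} - 7 x_{k-2} + 7 x_{k-3} - 2 x_{k-4} ≤ b_k`. -/
def deformedCube (m : ℕ) (ε : ℝ) (b : Fin m → ℝ) : Set (Fin m → ℝ) :=
  {x | ∀ i, (bandMatrix m ε).mulVec x i ≤ b i ∧ (bandMatrix m (-ε)).mulVec x i ≤ b i}

/-- The face of `D_m^ε` that belongs to a pattern: for every `k` that is not free, one inequality of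
the `k`-th pair is required to be tight (the one with `+ε` for the symbol `1`, the one with `-ε` for
the symbol `0`). -/
def deformedFace {m : ℕ} (ε : ℝ) (b : Fin m → ℝ) (σ : CubePattern m) : Set (Fin m → ℝ) :=
  {x ∈ deformedCube m ε b |
    ∀ i s, σ i = some s → (bandMatrix m (if s then ε else -ε)).mulVec x i = b i}

/-- The surface `Q_m^ε`: the cells of `D_m^ε` that correspond to the cells of `Q_m`. -/
def deformedSurface (m : ℕ) (ε : ℝ) (b : Fin m → ℝ) : Set (Set (Fin m → ℝ)) :=
  deformedFace ε b '' surfacePatterns m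

/-- `D_m^ε` is a polytope with the combinatorics of the `m`-cube: sending the face of `[0,1]^m` with
a given pattern to the face of `D_m^ε` with the same pattern is an inclusion-preserving and
inclusion-reflecting bijection onto the nonempty faces of `D_m^ε`. -/
structure IsCombinatorialCube (m : ℕ) (ε : ℝ) (b : Fin m → ℝ) : Prop where
  polytope : IsPolytope (deformedCube m ε b)
  bijOn : Set.BijOn (deformedFace ε b) Set.univ {G | IsFaceOf (deformedCube m ε b) G}
  subset_iff : ∀ σ τ : CubePattern m,
    deformedFace ε b σ ⊆ deformedFace ε b τ ↔ cubeFace σ ⊆ cubeFace τ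

/-- The projection of `ℝ^m` to its last four coordinates. -/
def lastFour (m : ℕ) (hm : 4 ≤ m) : (Fin m → ℝ) →ₗ[ℝ] (Fin 4 → ℝ) :=
  LinearMap.funLeft ℝ ℝ fun j : Fin 4 => (⟨m - 4 + j.val, by omega⟩ : Fin m)

end Cube

/-!
The argument is linear programming duality for one explicit dependency of the rows of the band.

A linear form that is a positive combination of exactly the inequalities tight on a face `G` of the
deformed cube `D` is maximal on `D` exactly along `G`. If such a form factors through the projection
`π`, then it exhibits `π(G)` as a face of `π(D)` and `G` as the full preimage of `π(G)` in `D`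
(`strictlyPreserved_tightFace`). So one needs coefficients `c` that vanish at the free positions of
the pattern, are positive elsewhere, and satisfy one linear equation for each coordinate that `π`
forgets. As the matrix is a band, these equations form the linear recursion
`±ε c_j + 2 c_{j+1} - 7 c_{j+2} + 7 c_{j+3} - 2 c_{j+4} = 0`. For `ε = 0` its characteristic polynomial
`2 - 7 r + 7 r² - 2 r³` has the roots `1`, `2`, `1/2`, so that there are three solutions `1`, `2^k`,
`2^{-k}`; the determinant of their values at `t`, `t + 1`, `k` vanishes at `k = t` and `k = t + 1`, and
up to a positive factor it is a Vandermonde determinant in powers of two, hence positive for all other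
`k` (also when the pair is the last and the first position). Continuing the initial values of the three
solutions by the perturbed recursion gives solutions that depend continuously on `ε`, so the
determinant still vanishes at the two positions and, for small `ε`, is positive at all others
(`eventually_dependencyDet_pos`). Sums of such solutions serve the patterns with fewer free positions
(`exists_dependency`).

Injectivity of `π` on a cell amounts to the statement that a vector which ends in four zeros and is
annihilated by all rows but two cyclically successive ones is zero (`eq_zero_of_rows_eq_zero`).
Injectivity on the union of the cells then follows, as each cell is the full preimage of its image, and
this makes the images of the cells a complex (`isPolyhedralEmbedding_of_strictlyPreserved`).

Both for the existence of deformed cubes and for the complex of their faces one uses that the faces of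
a polyhedron are cut out by making inequalities tight (`IsFaceOf.exists_eq_tightFace`). With
`q = 6 / ε` and `b_k = q^k` the coordinates on the polyhedron grow so slowly that the part of each
inequality below the diagonal never reaches `b_k`; the polyhedron is then an iterated bundle of
nondegenerate intervals (`isCombinatorialCube_pow`).
-/

/-! ### Faces of polytopes and of polyhedra given by inequalities -/

theorem IsPolytope.convex {E : Type*} [AddCommGroup E] [Module ℝ E] {P : Set E}
    (hP : IsPolytope P) : Convex ℝ P := by
  obtain ⟨S, -, rfl⟩ := hP
  exact convex_convexHull ℝ S

theorem IsPolytope.image {E F : Type*} [AddCommGroup E] [Module ℝ E]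
    [AddCommGroup F] [Module ℝ F] {P : Set E} (hP : IsPolytope P) (g : E →ₗ[ℝ] F) :
    IsPolytope (g '' P) := by
  obtain ⟨S, hS, rfl⟩ := hP
  exact ⟨g '' S, hS.image g, g.image_convexHull S⟩

section Polyhedra

variable {ι E F : Type*} [AddCommGroup E] [Module ℝ E] [TopologicalSpace E]
  [AddCommGroup F] [Module ℝ F] [TopologicalSpace F]

/-- The points of the polyhedron `{x | ∀ i, f i x ≤ b i}` at which the inequalities with index in `J`
are tight. The polyhedron itself is `tightFace f b ∅`. -/
def tightFace (f : ι → StrongDual ℝ E) (b : ι → ℝ) (J : Set ι) : Set E :=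
  {x | (∀ i, f i x ≤ b i) ∧ ∀ i ∈ J, f i x = b i}

variable {f : ι → StrongDual ℝ E} {b : ι → ℝ} {J K : Set ι}

theorem tightFace_anti (h : J ⊆ K) : tightFace f b K ⊆ tightFace f b J :=
  fun _ hx => ⟨hx.1, fun i hi => hx.2 i (h hi)⟩

theorem convex_tightFace : Convex ℝ (tightFace f b J) := by
  intro x hx y hy s t hs ht hst
  have hb : ∀ i, b i = s * b i + t * b i := fun i => by rw [← add_mul, hst, one_mul]
  refine ⟨fun i => ?_, fun i hi => ?_⟩
  · rw [map_add, map_smul, map_smul, smul_eq_mul, smul_eq_mul, hb i]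
    exact add_le_add (mul_le_mul_of_nonneg_left (hx.1 i) hs) (mul_le_mul_of_nonneg_left (hy.1 i) ht)
  · rw [map_add, map_smul, map_smul, smul_eq_mul, smul_eq_mul, hx.2 i hi, hy.2 i hi, ← hb i]

/-- A convex subset of a polyhedron contains a point at which only those inequalities are tight that
are tight on the whole subset. -/
theorem exists_mem_forall_lt [Finite ι] {S : Set E} (hS : Convex ℝ S) (hne : S.Nonempty)
    (hSP : ∀ x ∈ S, ∀ i, f i x ≤ b i) :
    ∃ x ∈ S, ∀ i, (∃ y ∈ S, f i y < b i) → f i x < b i := by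
  classical
  have := Fintype.ofFinite ι
  suffices H : ∀ T : Finset ι, ∃ x ∈ S, ∀ i ∈ T, (∃ y ∈ S, f i y < b i) → f i x < b i by
    obtain ⟨x, hx, h⟩ := H Finset.univ
    exact ⟨x, hx, fun i => h i (Finset.mem_univ i)⟩
  intro T
  induction T using Finset.induction_on with
  | empty => exact ⟨hne.some, hne.some_mem, by simp⟩
  | insert j T _ ih =>
    obtain ⟨x, hx, h⟩ := ih
    by_cases hj : ∃ y ∈ S, f j y < b j
    · obtain ⟨y, hy, hyj⟩ := hj
      refine ⟨(1 / 2 : ℝ) • x + (1 / 2 : ℝ) • y, hS hx hy (by norm_num) (by norm_num) (by norm_num),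
        fun i hi hex => ?_⟩
      rw [map_add, map_smul, map_smul, smul_eq_mul, smul_eq_mul]
      have h1 := hSP x hx i
      have h2 := hSP y hy i
      rcases Finset.mem_insert.1 hi with rfl | hi
      · linarith
      · linarith [h i hi hex]
    · refine ⟨x, hx, fun i hi hex => ?_⟩
      rcases Finset.mem_insert.1 hi with rfl | hi
      · exact absurd hex hj
      · exact h i hi hex

/-- From a point of a polyhedron one can move a little in every direction along which the inequalities
that are tight at the point stay tight. -/
theorem exists_pos_add_smul_mem [Finite ι] {x z : E} (hx : x ∈ tightFace f b J)
    (hz : ∀ i, f i x = b i → f i z = 0) :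
    ∃ δ : ℝ, 0 < δ ∧ x + δ • z ∈ tightFace f b J := by
  have hev : ∀ᶠ δ : ℝ in nhdsWithin 0 (Set.Ioi 0), ∀ i, f i (x + δ • z) ≤ b i := by
    rw [Filter.eventually_all]
    intro i
    rcases (hx.1 i).eq_or_lt with h | h
    · exact Filter.Eventually.of_forall fun δ => by simp [hz i h, h]
    · have hc : Filter.Tendsto (fun δ : ℝ => f i x + δ * f i z) (nhds 0) (nhds (f i x)) := by
        have : Continuous fun δ : ℝ => f i x + δ * f i z := by fun_prop
        simpa using this.tendsto 0
      filter_upwards [nhdsWithin_le_nhds (hc.eventually (gt_mem_nhds h))] with δ hδ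
      simpa using hδ.le
  obtain ⟨δ, hδ, hpos⟩ := (hev.and self_mem_nhdsWithin).exists
  refine ⟨δ, hpos, hδ, fun i hi => ?_⟩
  have h := hx.2 i hi
  simp [hz i h, h]

theorem isExposed_tightFace [Finite ι] [ContinuousAdd E] (h : J ⊆ K) :
    IsExposed ℝ (tightFace f b J) (tightFace f b K) := by
  classical
  have := Fintype.ofFinite ι
  rintro ⟨p, hp⟩
  -- the sum of the inequalities in `K` is tight exactly where all of them are
  refine ⟨∑ i with i ∈ K, f i, Set.ext fun x => ⟨fun hx => ⟨tightFace_anti h hx, fun y hy => ?_⟩,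
    fun ⟨hx, hmax⟩ => ⟨hx.1, ?_⟩⟩⟩
  · simp only [sum_apply]
    refine Finset.sum_le_sum fun i hi => ?_
    rw [hx.2 i (by simpa using hi)]
    exact hy.1 i
  · have hle := hmax p (tightFace_anti h hp)
    simp only [sum_apply] at hle
    have heq : ∀ i ∈ ({i | i ∈ K} : Finset ι), f i x = f i p := by
      refine (Finset.sum_eq_sum_iff_of_le fun i hi => ?_).1 (le_antisymm ?_ hle)
      · rw [hp.2 i (by simpa using hi)]
        exact hx.1 i
      · refine Finset.sum_le_sum fun i hi => ?_
        rw [hp.2 i (by simpa using hi)]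
        exact hx.1 i
    intro i hi
    rw [heq i (by simpa using hi), hp.2 i hi]

/-- Every nonempty face of a polyhedron is cut out by turning some of the inequalities into
equations. The segment from any point of the candidate face to a point of the given face in general
position can be prolonged within the polyhedron, so that a linear function cannot attain its maximum
at the latter point without attaining it at the former. -/
theorem IsFaceOf.exists_eq_tightFace [Finite ι] {H : Set E} (h : IsFaceOf (tightFace f b J) H) :
    ∃ K, J ⊆ K ∧ H = tightFace f b K := by
  obtain ⟨l, hl⟩ := h.2 h.1
  have hsub : H ⊆ tightFace f b J := h.2.subset
  obtain ⟨x, hxH, hx⟩ := exists_mem_forall_lt (f := f) (b := b) (h.2.convex convex_tightFace) h.1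
    fun x hx i => (hsub hx).1 i
  refine ⟨{i | ∀ y ∈ H, f i y = b i}, fun i hi y hy => (hsub hy).2 i hi,
    Set.Subset.antisymm (fun y hy => ⟨(hsub hy).1, fun i hi => hi y hy⟩) fun y hy => ?_⟩
  have hyJ : y ∈ tightFace f b J := ⟨hy.1, fun i hi => hy.2 i fun w hw => (hsub hw).2 i hi⟩
  obtain ⟨δ, hδ, hmem⟩ := exists_pos_add_smul_mem (z := x - y) (hsub hxH) fun i hi => by
    have : ∀ w ∈ H, f i w = b i := fun w hw =>
      le_antisymm ((hsub hw).1 i) (not_lt.1 fun hlt => (hx i ⟨w, hw, hlt⟩).ne hi)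
    rw [map_sub, hi, hy.2 i this, sub_self]
  rw [hl] at hxH ⊢
  have h1 := hxH.2 _ hmem
  rw [map_add, map_smul, map_sub, smul_eq_mul] at h1
  have h2 : l x ≤ l y := by
    by_contra hlt
    nlinarith [mul_pos hδ (sub_pos.2 (not_le.1 hlt))]
  exact ⟨hyJ, fun w hw => (hxH.2 w hw).trans h2⟩

/-- An extreme point of a polyhedron is determined by the inequalities that are tight at it. -/
theorem finite_extremePoints_tightFace [Finite ι] :
    ((tightFace f b J).extremePoints ℝ).Finite := by
  refine Set.Finite.of_finite_image (f := fun x => {i | f i x = b i}) (Set.toFinite _)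
    fun x hx y hy hxy => ?_
  have htight : ∀ i, f i x = b i → f i y = b i := fun i hi => (Set.ext_iff.1 hxy i).1 hi
  obtain ⟨δ, hδ, hmem⟩ := exists_pos_add_smul_mem (z := x - y) hx.1 fun i hi => by
    rw [map_sub, hi, htight i hi, sub_self]
  have hpos : 0 < 1 + δ := by linarith
  have hseg : x ∈ openSegment ℝ y (x + δ • (x - y)) := by
    refine ⟨δ / (1 + δ), 1 / (1 + δ), by positivity, by positivity, by field_simp; ring, ?_⟩
    have : x = ((1 + δ) / (1 + δ)) • x := by rw [div_self hpos.ne', one_smul]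
    conv_rhs => rw [this]
    module
  exact (hx.2 hy.1 hmem hseg).symm

theorem IsCompact.isPolytope_of_finite_extremePoints [IsTopologicalAddGroup E] [ContinuousSMul ℝ E]
    [T2Space E] [LocallyConvexSpace ℝ E] {P : Set E} (hc : IsCompact P) (hconv : Convex ℝ P)
    (hfin : (P.extremePoints ℝ).Finite) : IsPolytope P := by
  refine ⟨_, hfin, ?_⟩
  have h := closure_convexHull_extremePoints hc hconv
  rwa [(hfin.isClosed_convexHull ℝ).closure_eq, eq_comm] at h

theorem IsPolytope.isCompact [IsTopologicalAddGroup E] [ContinuousSMul ℝ E] {P : Set E}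
    (hP : IsPolytope P) : IsCompact P := by
  obtain ⟨S, hS, rfl⟩ := hP
  exact hS.isCompact_convexHull ℝ

theorem IsPolytope.of_isFaceOf [IsTopologicalAddGroup E] [ContinuousSMul ℝ E]
    [T2Space E] [LocallyConvexSpace ℝ E] {P G : Set E} (hP : IsPolytope P) (h : IsFaceOf P G) :
    IsPolytope G := by
  refine (h.2.isCompact hP.isCompact).isPolytope_of_finite_extremePoints (h.2.convex hP.convex) ?_
  obtain ⟨S, hS, rfl⟩ := hP
  exact hS.subset (h.2.isExtreme.extremePoints_subset_extremePoints.trans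
    extremePoints_convexHull_subset)

/-- If some point satisfies strictly all inequalities that are not imposed to be tight, the face has
as direction the whole solution space of the homogeneous equations. -/
theorem mem_vectorSpan_tightFace [Finite ι] {x : E} (hx : x ∈ tightFace f b J)
    (hlt : ∀ i, i ∉ J → f i x < b i) (z : E) :
    z ∈ vectorSpan ℝ (tightFace f b J) ↔ ∀ i ∈ J, f i z = 0 := by
  constructor
  · intro hz i hi
    have hle : vectorSpan ℝ (tightFace f b J) ≤ LinearMap.ker (f i : E →ₗ[ℝ] ℝ) := by
      rw [vectorSpan_def, Submodule.span_le]
      rintro _ ⟨y, hy, w, hw, rfl⟩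
      simp [hy.2 i hi, hw.2 i hi]
    exact hle hz
  · intro hz
    obtain ⟨δ, hδ, hmem⟩ := exists_pos_add_smul_mem (z := z) hx fun i hi =>
      hz i (by_contra fun hJ => (hlt i hJ).ne hi)
    have h1 := Submodule.smul_mem _ δ⁻¹ (vsub_mem_vectorSpan ℝ hmem hx)
    simpa [smul_smul, inv_mul_cancel₀ hδ.ne'] using h1

/-- A positive combination of exactly the inequalities that are tight on a face, if it factors through
a linear map, certifies that the map preserves the face strictly. -/
theorem strictlyPreserved_tightFace [Fintype ι] [ContinuousAdd E] {π : E →ₗ[ℝ] F}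
    (hne : (tightFace f b J).Nonempty) (c : ι → ℝ) (hpos : ∀ i ∈ J, 0 < c i)
    (hzero : ∀ i, i ∉ J → c i = 0) (g : StrongDual ℝ F) (hg : ∀ x, ∑ i, c i * f i x = g (π x))
    (hinj : Set.InjOn π (tightFace f b J)) :
    StrictlyPreserved π (tightFace f b ∅) (tightFace f b J) := by
  have hterm : ∀ x ∈ tightFace f b ∅, ∀ i, c i * f i x ≤ c i * b i := fun x hx i => by
    by_cases hi : i ∈ J
    · exact mul_le_mul_of_nonneg_left (hx.1 i) (hpos i hi).le
    · simp [hzero i hi]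
  have hsub : tightFace f b J ⊆ tightFace f b ∅ := tightFace_anti (Set.empty_subset J)
  have hle : ∀ x ∈ tightFace f b ∅, g (π x) ≤ ∑ i, c i * b i := fun x hx =>
    hg x ▸ Finset.sum_le_sum fun i _ => hterm x hx i
  have hiff : ∀ x ∈ tightFace f b ∅, x ∈ tightFace f b J ↔ g (π x) = ∑ i, c i * b i := by
    intro x hx
    rw [← hg x, Finset.sum_eq_sum_iff_of_le fun i _ => hterm x hx i]
    refine ⟨fun h i _ => ?_, fun h => ⟨hx.1, fun i hi => ?_⟩⟩
    · by_cases hi : i ∈ J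
      · rw [h.2 i hi]
      · simp [hzero i hi]
    · exact mul_left_cancel₀ (hpos i hi).ne' (h i (Finset.mem_univ i))
  refine ⟨⟨hne, isExposed_tightFace (Set.empty_subset J)⟩, ⟨hne.image π, fun _ => ⟨g, ?_⟩⟩, ?_, hinj⟩
  · obtain ⟨p, hp⟩ := hne
    ext w
    constructor
    · rintro ⟨x, hx, rfl⟩
      refine ⟨⟨x, hsub hx, rfl⟩, ?_⟩
      rintro _ ⟨y, hy, rfl⟩
      rw [(hiff x (hsub hx)).1 hx]
      exact hle y hy
    · rintro ⟨⟨x, hx, rfl⟩, hmax⟩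
      have h1 := hmax _ ⟨p, hsub hp, rfl⟩
      rw [(hiff p (hsub hp)).1 hp] at h1
      exact ⟨x, (hiff x hx).2 (le_antisymm (hle x hx) h1), rfl⟩
  · ext x
    constructor
    · rintro ⟨hx, y, hy, hxy⟩
      rw [hiff x hx, ← hxy]
      exact (hiff y (hsub hy)).1 hy
    · exact fun hx => ⟨hsub hx, x, hx, rfl⟩

end Polyhedra

/-! ### Complexes of strictly preserved faces -/

theorem polyDim_image_of_disjoint {E F : Type*} [AddCommGroup E] [Module ℝ E]
    [AddCommGroup F] [Module ℝ F] {π : E →ₗ[ℝ] F} {G : Set E}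
    (h : Disjoint (vectorSpan ℝ G) (LinearMap.ker π)) :
    polyDim (π '' G) = polyDim G := by
  have hmap : vectorSpan ℝ (π '' G) = (vectorSpan ℝ G).map π := by
    simpa using (π.toAffineMap.map_vectorSpan (s := G)).symm
  rw [polyDim, polyDim, hmap, ← LinearMap.range_domRestrict]
  exact LinearMap.finrank_range_of_inj (LinearMap.injective_domRestrict_iff.2 h)

section Projection

variable {E F : Type*} [AddCommGroup E] [Module ℝ E] [TopologicalSpace E]
  [AddCommGroup F] [Module ℝ F] [TopologicalSpace F] {π : E →ₗ[ℝ] F} {P : Set E}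

theorem StrictlyPreserved.subset {G : Set E} (h : StrictlyPreserved π P G) : G ⊆ P := h.1.2.subset

theorem injOn_sUnion_of_strictlyPreserved {K : Set (Set E)}
    (hK : ∀ G ∈ K, StrictlyPreserved π P G) : Set.InjOn π (⋃₀ K) := by
  rintro x ⟨G, hG, hx⟩ y ⟨H, hH, hy⟩ hxy
  obtain ⟨-, -, hpre, hinj⟩ := hK G hG
  have hyG : y ∈ G := by
    rw [← hpre]
    exact ⟨(hK H hH).subset hy, x, hx, hxy⟩
  exact hinj hx hyG hxy

/-- A linear map that preserves strictly all cells of a complex of faces of a polytope, and is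
injective on their directions, embeds the complex. -/
theorem isPolyhedralEmbedding_of_strictlyPreserved [IsTopologicalAddGroup E] [ContinuousSMul ℝ E]
    [T2Space F] {K : Set (Set E)} (hcont : Continuous π)
    (hK : IsPolyhedralComplex K) (hpres : ∀ G ∈ K, StrictlyPreserved π P G)
    (hdisj : ∀ G ∈ K, Disjoint (vectorSpan ℝ G) (LinearMap.ker π)) :
    IsPolyhedralEmbedding π K := by
  have hinj := injOn_sUnion_of_strictlyPreserved hpres
  have hsub : ∀ G ∈ K, G ⊆ ⋃₀ K := fun G hG => Set.subset_sUnion_of_mem hG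
  have hinter : ∀ G ∈ K, ∀ H ∈ K, π '' G ∩ π '' H = π '' (G ∩ H) := fun G hG H hH =>
    (hinj.image_inter (hsub G hG) (hsub H hH)).symm
  refine ⟨hK, ⟨hK.finite.image _, ?_, ?_, ?_, ?_⟩, ?_,
    fun G hG => polyDim_image_of_disjoint (hdisj G hG),
    fun G hG H hH => hinj.image_subset_image_iff (hsub G hG) (hsub H hH), hinter⟩
  · rintro _ ⟨G, hG, rfl⟩
    exact (hK.nonempty G hG).image π
  · rintro _ ⟨G, hG, rfl⟩
    exact (hK.polytope G hG).image π
  · rintro _ ⟨G, hG, rfl⟩ H hH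
    obtain ⟨l, hl⟩ := hH.2 hH.1
    -- the preimage of a face of the image is a face
    have himage : π '' (G ∩ π ⁻¹' H) = H := by
      rw [Set.image_inter_preimage]
      exact Set.inter_eq_right.2 hH.2.subset
    refine ⟨G ∩ π ⁻¹' H, hK.face_mem G hG _ ⟨?_, fun _ => ⟨l.comp ⟨π, hcont⟩, ?_⟩⟩, himage⟩
    · rw [← Set.image_nonempty (f := π), himage]
      exact hH.1
    · ext x
      simp only [hl, Set.mem_inter_iff, Set.mem_preimage, Set.mem_ofPred_eq, Set.forall_mem_image,
        ContinuousLinearMap.comp_apply, ContinuousLinearMap.coe_mk']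
      exact ⟨fun h => ⟨h.1, h.2.2⟩, fun h => ⟨h.1, ⟨x, h.1, rfl⟩, h.2⟩⟩
  · rintro _ ⟨G, hG, rfl⟩ _ ⟨H, hH, rfl⟩ hne
    simp only at hne ⊢
    rw [hinter G hG H hH] at hne ⊢
    have hmem := hK.face_mem G hG _ (hK.inter_face G hG H hH hne.of_image).1
    obtain ⟨-, ⟨hne', hexp⟩, -, -⟩ := hpres _ hmem
    exact ⟨⟨hne', hexp.mono (Set.image_mono (hpres G hG).subset) (Set.image_mono Set.inter_subset_left)⟩,
      ⟨hne', hexp.mono (Set.image_mono (hpres H hH).subset) (Set.image_mono Set.inter_subset_right)⟩⟩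
  · have hcomp : IsCompact (⋃₀ K) := hK.finite.isCompact_sUnion fun G hG => (hK.polytope G hG).isCompact
    have : CompactSpace (⋃₀ K) := isCompact_iff_compactSpace.1 hcomp
    exact ((hcont.comp continuous_subtype_val).isClosedEmbedding
      (Set.injOn_iff_injective.1 hinj)).isEmbedding

end Projection

/-! ### The band matrix -/

section Band

variable {m : ℕ}

/-- The coordinates of a vector, moved up by four places and continued by zero to all natural numbers,
so that the band formula needs no case distinction at the first four coordinates. -/
noncomputable def padded (x : Fin m → ℝ) (n : ℕ) : ℝ :=
  if h : 4 ≤ n ∧ n < m + 4 then x ⟨n - 4, by omega⟩ else 0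

theorem padded_add_four (x : Fin m → ℝ) (i : Fin m) : padded x (i.val + 4) = x i := by
  have : 4 ≤ i.val + 4 ∧ i.val + 4 < m + 4 := by omega
  simp [padded, this]

theorem padded_of_lt (x : Fin m → ℝ) {n : ℕ} (h : n < 4) : padded x n = 0 :=
  dif_neg fun hn => by omega

theorem abs_padded_le (x : Fin m → ℝ) (n : ℕ) : |padded x n| ≤ ‖x‖ := by
  unfold padded
  split_ifs
  · exact norm_le_pi_norm x _
  · simp

theorem sum_ite_eq_padded (x : Fin m → ℝ) (i : Fin m) {n d : ℕ} (hd : d ≤ 4)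
    (h : n + d = i.val + 4) :
    ∑ j : Fin m, (if i.val = j.val + d then x j else 0) = padded x n := by
  by_cases hn : 4 ≤ n
  · have hi := i.isLt
    rw [Finset.sum_eq_single (⟨n - 4, by omega⟩ : Fin m), if_pos (by simp only; omega)]
    · have : 4 ≤ n ∧ n < m + 4 := by omega
      simp [padded, this]
    · intro j _ hj
      refine if_neg fun hij => hj (Fin.ext ?_)
      simp only
      omega
    · simp
  · rw [padded_of_lt x (by omega)]
    exact Finset.sum_eq_zero fun j _ => if_neg (by omega)

/-- The part of the `i`-th inequality that lies below the diagonal. -/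
noncomputable def bandTail (x : Fin m → ℝ) (i : ℕ) : ℝ :=
  2 * padded x (i + 3) - 7 * padded x (i + 2) + 7 * padded x (i + 1) - 2 * padded x i

theorem bandMatrix_mulVec (δ : ℝ) (x : Fin m → ℝ) (i : Fin m) :
    (bandMatrix m δ).mulVec x i = δ * x i + bandTail x i := by
  have hentry : ∀ j, bandMatrix m δ i j * x j =
      δ * (if i.val = j.val + 0 then x j else 0) + (2 * (if i.val = j.val + 1 then x j else 0) -
      7 * (if i.val = j.val + 2 then x j else 0) + 7 * (if i.val = j.val + 3 then x j else 0) -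
      2 * (if i.val = j.val + 4 then x j else 0)) := by
    intro j
    simp only [bandMatrix, Matrix.of_apply, add_zero]
    split_ifs <;> first | omega | ring
  rw [Matrix.mulVec, dotProduct]
  simp only [hentry, Finset.sum_add_distrib, Finset.sum_sub_distrib, ← Finset.mul_sum]
  rw [sum_ite_eq_padded x i (n := i + 4) (by norm_num) (by omega),
    sum_ite_eq_padded x i (n := i + 3) (by norm_num) (by omega),
    sum_ite_eq_padded x i (n := i + 2) (by norm_num) (by omega),
    sum_ite_eq_padded x i (n := i + 1) (by norm_num) (by omega),
    sum_ite_eq_padded x i (n := i) (by norm_num) (by omega), padded_add_four, bandTail]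

/-- Systems with a nonzero diagonal, whose part below the diagonal consists of multiples of the rows
of the band, are uniquely solvable, as they are triangular. -/
theorem bijective_diag_add_bandTail (d y : Fin m → ℝ) (hd : ∀ i, d i ≠ 0) :
    ∃ e : (Fin m → ℝ) ≃ₗ[ℝ] (Fin m → ℝ), ∀ x i, e x i = d i * x i + y i * bandTail x i := by
  let N : Matrix (Fin m) (Fin m) ℝ := Matrix.diagonal d + Matrix.diagonal y * bandMatrix m 0
  have hN : ∀ x i, N.mulVec x i = d i * x i + y i * bandTail x i := fun x i => by
    simp only [N, Matrix.add_mulVec, ← Matrix.mulVec_mulVec, Pi.add_apply, Matrix.mulVec_diagonal,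
      bandMatrix_mulVec, zero_mul, zero_add]
  have htri : N.BlockTriangular OrderDual.toDual := by
    intro i j hij
    have hij : i < j := hij
    have hne : i ≠ j := hij.ne
    have hlt : i.val < j.val := hij
    have h0 : bandMatrix m 0 i j = 0 := by
      simp only [bandMatrix, Matrix.of_apply]
      split_ifs <;> first | rfl | omega
    simp [N, Matrix.diagonal_apply_ne d hne, Matrix.diagonal_mul, h0]
  have hdet : IsUnit N.det := by
    rw [Matrix.det_of_isLowerTriangular N htri, isUnit_iff_ne_zero, Finset.prod_ne_zero_iff]
    intro i _
    simpa [N, Matrix.diagonal_mul, bandMatrix] using hd i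
  have hunit : IsUnit N := (Matrix.isUnit_iff_isUnit_det N).2 hdet
  exact ⟨LinearEquiv.ofBijective N.mulVecLin
    ⟨Matrix.mulVec_injective_iff_isUnit.2 hunit, Matrix.mulVec_surjective_iff_isUnit.2 hunit⟩, hN⟩

theorem sum_ite_val_eq (c : ℕ → ℝ) {n : ℕ} (hn : n < m) :
    ∑ i : Fin m, (if i.val = n then c i else 0) = c n := by
  rw [Finset.sum_eq_single (⟨n, hn⟩ : Fin m)]
  · simp
  · intro i _ hi
    exact if_neg fun h => hi (Fin.ext h)
  · simp

/-- A combination of the rows with coefficients that satisfy the recursion read off from the columns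
does not involve the coordinates other than the last four. -/
theorem sum_mul_bandMatrix_mulVec_eq_zero {δ c : ℕ → ℝ}
    (hc : ∀ n, δ n * c n + 2 * c (n + 1) - 7 * c (n + 2) + 7 * c (n + 3) - 2 * c (n + 4) = 0)
    {x : Fin m → ℝ} (hx : ∀ j : Fin m, m ≤ j.val + 4 → x j = 0) :
    ∑ i : Fin m, c i * (bandMatrix m (δ i)).mulVec x i = 0 := by
  simp only [Matrix.mulVec, dotProduct, Finset.mul_sum]
  rw [Finset.sum_comm]
  refine Finset.sum_eq_zero fun j _ => ?_
  rcases le_or_gt m (j.val + 4) with hj | hj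
  · simp [hx j hj]
  · have hentry : ∀ i : Fin m, c i * (bandMatrix m (δ i) i j * x j) =
        (δ j * (if i.val = j.val then c i else 0) + 2 * (if i.val = j.val + 1 then c i else 0) -
        7 * (if i.val = j.val + 2 then c i else 0) + 7 * (if i.val = j.val + 3 then c i else 0) -
        2 * (if i.val = j.val + 4 then c i else 0)) * x j := by
      intro i
      simp only [bandMatrix, Matrix.of_apply]
      by_cases hij : i.val = j.val
      · rw [hij]; simp; ring
      · split_ifs <;> first | omega | ring
    simp only [hentry, ← Finset.sum_mul, Finset.sum_add_distrib, Finset.sum_sub_distrib,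
      ← Finset.mul_sum]
    rw [sum_ite_val_eq c j.isLt, sum_ite_val_eq c (by omega), sum_ite_val_eq c (by omega),
      sum_ite_val_eq c (by omega), sum_ite_val_eq c hj, hc j, zero_mul]

/-! ### Vectors annihilated by almost all rows -/

theorem succ_mod_eq_ite {m t : ℕ} (ht : t < m) : (t + 1) % m = if t + 1 = m then 0 else t + 1 := by
  split_ifs with h
  · rw [h, Nat.mod_self]
  · exact Nat.mod_eq_of_lt (by omega)

/-- A vector whose last four coordinates vanish, and which is annihilated by all rows but two
cyclically successive ones, is zero. If the two rows are not the last and the first one, the rows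
above them and the diagonal give the vanishing of the first coordinates, while the rows below them and
the entries `-2` at the lower end of the band give the vanishing of the others. In the remaining case,
where the rows from the second one on are solved by means of the entries `2` next to the diagonal,
the coordinates are bounded by small multiples of their maximum. -/
theorem eq_zero_of_rows_eq_zero {ε : ℝ} (hε : 0 < ε) (hε' : 8 ^ m * ε < 1) {d : Fin m → ℝ}
    (hd : ∀ i, |d i| = ε) {t : Fin m} {z : Fin m → ℝ} (hlast : ∀ j : Fin m, m ≤ j.val + 4 → z j = 0)
    (hrow : ∀ i : Fin m, i ≠ t → i.val ≠ (t.val + 1) % m → d i * z i + bandTail z i = 0) :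
    z = 0 := by
  suffices H : ∀ n, padded z n = 0 by
    ext i
    rw [← padded_add_four z i, H, Pi.zero_apply]
  have htail : ∀ n, m ≤ n → padded z n = 0 := fun n hn => by
    unfold padded
    split_ifs with h
    · exact hlast _ (by simp only; omega)
    · rfl
  have hrow' : ∀ i (hi : i < m), i ≠ t → i ≠ (t.val + 1) % m →
      d ⟨i, hi⟩ * padded z (i + 4) + bandTail z i = 0 := fun i hi h1 h2 => by
    have := hrow ⟨i, hi⟩ (fun h => h1 (by rw [← h])) h2
    rwa [← padded_add_four z] at this
  have ht := t.isLt
  rw [succ_mod_eq_ite ht] at hrow'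
  by_cases hlt : t.val + 1 = m
  · rw [if_pos hlt] at hrow'
    -- the `i`-th row expresses the coordinate below the `i`-th by the three preceding ones and the
    -- small term `d i * z i`
    have hbound : ∀ n, |padded z n| ≤ 8 ^ n * (ε * ‖z‖) := by
      intro n
      induction n using Nat.strong_induction_on with
      | _ n ih =>
        have hnn : 0 ≤ ε * ‖z‖ := by positivity
        rcases lt_or_ge n 4 with h4 | h4
        · rw [padded_of_lt z h4, abs_zero]
          positivity
        rcases le_or_gt m n with hm | hm
        · rw [htail n hm, abs_zero]
          positivity
        obtain ⟨i, rfl⟩ : ∃ i, n = i + 3 := ⟨n - 3, by omega⟩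
        have hr := hrow' i (by omega) (by omega) (by omega)
        have h0 := abs_le.1 (ih i (by omega))
        have h1 := abs_le.1 (ih (i + 1) (by omega))
        have h2 := abs_le.1 (ih (i + 2) (by omega))
        have hdz : |d ⟨i, by omega⟩ * padded z (i + 4)| ≤ ε * ‖z‖ := by
          rw [abs_mul, hd]
          exact mul_le_mul_of_nonneg_left (abs_padded_le z _) hε.le
        have h3 := abs_le.1 hdz
        have h8 : ε * ‖z‖ ≤ 8 ^ i * (ε * ‖z‖) :=
          le_mul_of_one_le_left hnn (one_le_pow₀ (by norm_num))
        simp only [pow_add, bandTail] at *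
        rw [abs_le]
        constructor <;> linarith
    have hle : ∀ i, ‖z i‖ ≤ 8 ^ m * ε * ‖z‖ := fun i => by
      rw [← padded_add_four z i, Real.norm_eq_abs]
      rcases le_or_gt m (i.val + 4) with h | h
      · rw [htail _ h, abs_zero]
        positivity
      · refine (hbound _).trans ?_
        rw [mul_assoc]
        gcongr
        norm_num
    have hz : ‖z‖ ≤ 8 ^ m * ε * ‖z‖ := (pi_norm_le_iff_of_nonneg (by positivity)).2 hle
    have hz0 : ‖z‖ = 0 := by
      by_contra hne
      have : 0 < ‖z‖ := (norm_nonneg z).lt_of_ne' hne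
      nlinarith
    rw [norm_eq_zero] at hz0
    intro n
    simp [hz0, padded]
  · rw [if_neg hlt] at hrow'
    have hlow : ∀ n, n < t.val + 4 → padded z n = 0 := by
      intro n
      induction n using Nat.strong_induction_on with
      | _ n ih =>
        intro hn
        rcases lt_or_ge n 4 with h4 | h4
        · exact padded_of_lt z h4
        obtain ⟨i, rfl⟩ : ∃ i, n = i + 4 := ⟨n - 4, by omega⟩
        have hr := hrow' i (by omega) (by omega) (by omega)
        rw [bandTail, ih i (by omega) (by omega), ih (i + 1) (by omega) (by omega),
          ih (i + 2) (by omega) (by omega), ih (i + 3) (by omega) (by omega)] at hr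
        have hd0 : d ⟨i, by omega⟩ ≠ 0 := abs_pos.1 (by rw [hd]; exact hε)
        simpa [hd0] using hr
    have hhigh : ∀ k n, m ≤ n + k → t.val + 2 ≤ n → padded z n = 0 := by
      intro k
      induction k with
      | zero => exact fun n hn _ => htail n hn
      | succ k ih =>
        intro n hn htn
        rcases le_or_gt m n with h | h
        · exact htail n h
        have hr := hrow' n h (by omega) (by omega)
        rw [bandTail, ih (n + 1) (by omega) (by omega), ih (n + 2) (by omega) (by omega),
          ih (n + 3) (by omega) (by omega), ih (n + 4) (by omega) (by omega)] at hr
        linarith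
    intro n
    rcases lt_or_ge n (t.val + 4) with h | h
    · exact hlow n h
    · exact hhigh m n (by omega) (by omega)

end Band

/-! ### Positive dependencies of the rows -/

section Dependency

/-- The solution of the recursion `δ n * c n + 2 c (n + 1) - 7 c (n + 2) + 7 c (n + 3) - 2 c (n + 4) = 0`
that starts like the powers of `r`. -/
noncomputable def dependencySeq (δ : ℕ → ℝ) (r : ℝ) : ℕ → ℝ
  | 0 => 1
  | 1 => r
  | 2 => r ^ 2
  | 3 => r ^ 3
  | n + 4 => (δ n * dependencySeq δ r n + 2 * dependencySeq δ r (n + 1) -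
      7 * dependencySeq δ r (n + 2) + 7 * dependencySeq δ r (n + 3)) / 2

theorem dependencySeq_rec (δ : ℕ → ℝ) (r : ℝ) (n : ℕ) :
    dependencySeq δ r (n + 4) = (δ n * dependencySeq δ r n + 2 * dependencySeq δ r (n + 1) -
      7 * dependencySeq δ r (n + 2) + 7 * dependencySeq δ r (n + 3)) / 2 := by
  rw [dependencySeq]

theorem dependencySeq_zero {r : ℝ} (hr : 2 - 7 * r + 7 * r ^ 2 - 2 * r ^ 3 = 0) (n : ℕ) :
    dependencySeq 0 r n = r ^ n := by
  induction n using Nat.strong_induction_on with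
  | _ n ih =>
    match n, ih with
    | 0, _ => simp [dependencySeq]
    | 1, _ => simp [dependencySeq]
    | 2, _ => simp [dependencySeq]
    | 3, _ => simp [dependencySeq]
    | n + 4, ih =>
      rw [dependencySeq_rec, ih (n + 1) (by omega), ih (n + 2) (by omega), ih (n + 3) (by omega)]
      simp only [Pi.zero_apply, zero_mul]
      linear_combination (r ^ (n + 1) / 2) * hr

theorem continuous_dependencySeq {δ : ℝ → ℕ → ℝ} (hδ : ∀ n, Continuous fun ε => δ ε n) (r : ℝ) (n : ℕ) :
    Continuous fun ε => dependencySeq (δ ε) r n := by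
  induction n using Nat.strong_induction_on with
  | _ n ih =>
    match n, ih with
    | 0, _ => simpa [dependencySeq] using continuous_const
    | 1, _ => simpa [dependencySeq] using continuous_const
    | 2, _ => simpa [dependencySeq] using continuous_const
    | 3, _ => simpa [dependencySeq] using continuous_const
    | n + 4, ih =>
      have h0 := ih n (by omega)
      have h1 := ih (n + 1) (by omega)
      have h2 := ih (n + 2) (by omega)
      have h3 := ih (n + 3) (by omega)
      have h := hδ n
      simp only [dependencySeq_rec]
      fun_prop

/-- The determinant of three solutions of the recursion, which start like the powers of the roots
`1`, `2`, `1/2` of the unperturbed characteristic polynomial, at the places `t`, `t'`, `k`. As a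
function of `k` it is a solution of the recursion that vanishes at `t` and `t'`. -/
noncomputable def dependencyDet (δ : ℕ → ℝ) (t t' k : ℕ) : ℝ :=
  Matrix.det !![dependencySeq δ 1 t, dependencySeq δ 1 t', dependencySeq δ 1 k;
    dependencySeq δ 2 t, dependencySeq δ 2 t', dependencySeq δ 2 k;
    dependencySeq δ (1 / 2) t, dependencySeq δ (1 / 2) t', dependencySeq δ (1 / 2) k]

theorem dependencyDet_eq (δ : ℕ → ℝ) (t t' k : ℕ) : dependencyDet δ t t' k =
    dependencySeq δ 1 t *
        (dependencySeq δ 2 t' * dependencySeq δ (1 / 2) k -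
          dependencySeq δ 2 k * dependencySeq δ (1 / 2) t') -
      dependencySeq δ 1 t' *
        (dependencySeq δ 2 t * dependencySeq δ (1 / 2) k -
          dependencySeq δ 2 k * dependencySeq δ (1 / 2) t) +
      dependencySeq δ 1 k *
        (dependencySeq δ 2 t * dependencySeq δ (1 / 2) t' -
          dependencySeq δ 2 t' * dependencySeq δ (1 / 2) t) := by
  simp only [dependencyDet, Matrix.det_fin_three, Matrix.of_apply, Matrix.cons_val', Matrix.cons_val]
  ring

theorem dependencyDet_left (δ : ℕ → ℝ) (t t' : ℕ) : dependencyDet δ t t' t = 0 := by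
  rw [dependencyDet_eq]
  ring

theorem dependencyDet_right (δ : ℕ → ℝ) (t t' : ℕ) : dependencyDet δ t t' t' = 0 := by
  rw [dependencyDet_eq]
  ring

theorem dependencyDet_rec (δ : ℕ → ℝ) (t t' n : ℕ) :
    δ n * dependencyDet δ t t' n + 2 * dependencyDet δ t t' (n + 1) -
      7 * dependencyDet δ t t' (n + 2) + 7 * dependencyDet δ t t' (n + 3) -
      2 * dependencyDet δ t t' (n + 4) = 0 := by
  simp only [dependencyDet_eq, dependencySeq_rec]
  ring

theorem continuous_dependencyDet {δ : ℝ → ℕ → ℝ} (hδ : ∀ n, Continuous fun ε => δ ε n) (t t' k : ℕ) :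
    Continuous fun ε => dependencyDet (δ ε) t t' k := by
  have h := fun r n => continuous_dependencySeq hδ r n
  simp only [dependencyDet_eq]
  fun_prop

/-- In the limit the determinant is, up to a positive factor, a Vandermonde determinant in powers of
two. -/
theorem dependencyDet_zero_pos {m t k : ℕ} (ht : t < m) (hk : k < m) (h1 : k ≠ t)
    (h2 : k ≠ (t + 1) % m) : 0 < dependencyDet 0 t ((t + 1) % m) k := by
  have hmono : ∀ {a b : ℕ}, a < b → (2 : ℝ) ^ a < 2 ^ b := fun h =>
    pow_lt_pow_right₀ (by norm_num) h
  rw [succ_mod_eq_ite ht] at h2 ⊢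
  set t' := if t + 1 = m then 0 else t + 1 with ht'
  have hV : 0 < ((2 : ℝ) ^ t' - 2 ^ t) * (2 ^ k - 2 ^ t) * (2 ^ k - 2 ^ t') := by
    split_ifs at ht' with h
    -- the pair consists of the last and the first position: `t'` lies below `k` and `k` below `t`
    · have hk0 := hmono (show t' < k by omega)
      have hkt := hmono (show k < t by omega)
      have hneg := mul_pos_of_neg_of_neg (sub_neg.2 (hk0.trans hkt)) (sub_neg.2 hkt)
      exact mul_pos hneg (sub_pos.2 hk0)
    · have htt := hmono (show t < t' by omega)
      rcases lt_or_gt_of_ne h1 with hlt | hgt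
      · have hkt := hmono hlt
        rw [mul_assoc]
        exact mul_pos (sub_pos.2 htt)
          (mul_pos_of_neg_of_neg (sub_neg.2 hkt) (sub_neg.2 (hkt.trans htt)))
      · have htk := hmono (show t' < k by omega)
        exact mul_pos (mul_pos (sub_pos.2 htt) (sub_pos.2 (htt.trans htk))) (sub_pos.2 htk)
  have hdet : dependencyDet 0 t t' k =
      (((2 : ℝ) ^ t' - 2 ^ t) * (2 ^ k - 2 ^ t) * (2 ^ k - 2 ^ t')) / (2 ^ t * 2 ^ t' * 2 ^ k) := by
    rw [dependencyDet_eq]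
    simp only [dependencySeq_zero (r := 1) (by norm_num), dependencySeq_zero (r := 2) (by norm_num),
      dependencySeq_zero (r := 1 / 2) (by norm_num), one_pow]
    simp only [one_div, inv_pow]
    field_simp
    ring
  rw [hdet]
  positivity

/-- The diagonal entries `±ε` of the rows selected by `s`, continued by zero. -/
noncomputable def signedDiag {m : ℕ} (s : Fin m → Bool) (ε : ℝ) (n : ℕ) : ℝ :=
  if h : n < m then (if s ⟨n, h⟩ then ε else -ε) else 0

theorem signedDiag_val {m : ℕ} (s : Fin m → Bool) (ε : ℝ) (i : Fin m) :
    signedDiag s ε i = if s i then ε else -ε := by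
  simp [signedDiag]

theorem eventually_dependencyDet_pos (m : ℕ) :
    ∀ᶠ ε : ℝ in nhds 0, ∀ (s : Fin m → Bool) (t k : Fin m), k ≠ t → k.val ≠ (t.val + 1) % m →
      0 < dependencyDet (signedDiag s ε) t ((t.val + 1) % m) k := by
  simp only [Filter.eventually_all]
  intro s t k h1 h2
  have hcont : Continuous fun ε => dependencyDet (signedDiag s ε) t ((t.val + 1) % m) k := by
    refine continuous_dependencyDet (fun n => ?_) _ _ _
    unfold signedDiag
    split_ifs <;> fun_prop
  have h0 : signedDiag s 0 = 0 := by
    ext n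
    simp [signedDiag]
  refine hcont.tendsto 0 |>.eventually (lt_mem_nhds ?_)
  rw [h0]
  exact dependencyDet_zero_pos t.isLt k.isLt (fun h => h1 (Fin.ext h)) h2

end Dependency

/-! ### Patterns and faces -/

section Patterns

variable {m : ℕ}

/-- The pairs `(i, s)` with `σ i = s`: the index set of the inequalities that a pattern makes tight. -/
def fixedSet (σ : CubePattern m) : Set (Fin m × Bool) :=
  {p | σ p.1 = some p.2}

theorem fixedSet_injective : Function.Injective (fixedSet (m := m)) := by
  intro σ τ h
  ext i s
  exact Set.ext_iff.1 h (i, s)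

theorem mem_surfacePatterns_of_fixedSet_subset {σ τ : CubePattern m} (hσ : σ ∈ surfacePatterns m)
    (h : fixedSet σ ⊆ fixedSet τ) : τ ∈ surfacePatterns m := by
  obtain ⟨t, ht⟩ := hσ
  refine ⟨t, fun i hi => ht i ?_⟩
  by_contra hne
  obtain ⟨s, hs⟩ := Option.ne_none_iff_exists'.1 hne
  have : τ i = some s := h (show (i, s) ∈ fixedSet σ from hs)
  simp [hi] at this

/-- The linear forms `x i` and `-x i`, whose upper bounds `1` and `0` define the standard cube. -/
noncomputable def unitForm (p : Fin m × Bool) : StrongDual ℝ (Fin m → ℝ) :=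
  (if p.2 then (1 : ℝ) else -1) • ContinuousLinearMap.proj p.1

theorem unitForm_apply (p : Fin m × Bool) (x : Fin m → ℝ) :
    unitForm p x = (if p.2 then (1 : ℝ) else -1) * x p.1 := rfl

theorem cubeFace_eq_tightFace (σ : CubePattern m) :
    cubeFace σ = tightFace unitForm (fun p => if p.2 then 1 else 0) (fixedSet σ) := by
  ext x
  simp only [cubeFace, tightFace, fixedSet, unitForm_apply, Prod.forall, Bool.forall_bool,
    Set.mem_ofPred_eq]
  constructor
  · rintro ⟨h1, h2⟩
    exact ⟨fun i => ⟨by simpa using (h1 i).1, by simpa using (h1 i).2⟩,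
      fun i => ⟨fun hi => by simpa using (h2 i).1 hi, fun hi => by simpa using (h2 i).2 hi⟩⟩
  · rintro ⟨h1, h2⟩
    exact ⟨fun i => ⟨by simpa using (h1 i).1, by simpa using (h1 i).2⟩,
      fun i => ⟨fun hi => by simpa using (h2 i).1 hi, fun hi => by simpa using (h2 i).2 hi⟩⟩

theorem exists_mem_cubeFace_forall_lt (σ : CubePattern m) :
    ∃ x ∈ cubeFace σ, ∀ p ∉ fixedSet σ, unitForm p x < if p.2 then 1 else 0 := by
  refine ⟨fun i => (σ i).elim (1 / 2) fun s => if s then 1 else 0, ⟨fun i => ?_, fun i s hi => ?_⟩, ?_⟩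
  · dsimp only
    rcases σ i with _ | _ | _ <;> norm_num
  · simp [hi]
  · rintro ⟨i, s⟩ hi
    have hi : σ i ≠ some s := hi
    rw [unitForm_apply]
    revert hi
    rcases σ i with _ | _ | _ <;> rcases s with _ | _ <;> norm_num

theorem cubeFace_subset_iff {σ τ : CubePattern m} :
    cubeFace σ ⊆ cubeFace τ ↔ fixedSet τ ⊆ fixedSet σ := by
  constructor
  · intro h p hp
    obtain ⟨x, hx, hlt⟩ := exists_mem_cubeFace_forall_lt σ
    by_contra hpσ
    have hxτ := h hx
    rw [cubeFace_eq_tightFace] at hxτ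
    exact (hlt p hpσ).ne (hxτ.2 p hp)
  · intro h
    rw [cubeFace_eq_tightFace, cubeFace_eq_tightFace]
    exact tightFace_anti h

theorem cubeFace_injective : Function.Injective (cubeFace (m := m)) := fun _ _ h =>
  fixedSet_injective (Set.Subset.antisymm (cubeFace_subset_iff.1 h.ge) (cubeFace_subset_iff.1 h.le))

theorem mem_vectorSpan_cubeFace (σ : CubePattern m) (z : Fin m → ℝ) :
    z ∈ vectorSpan ℝ (cubeFace σ) ↔ ∀ i, σ i ≠ none → z i = 0 := by
  obtain ⟨x, hx, hlt⟩ := exists_mem_cubeFace_forall_lt σ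
  rw [cubeFace_eq_tightFace] at hx ⊢
  rw [mem_vectorSpan_tightFace hx hlt]
  constructor
  · intro h i hi
    obtain ⟨s, hs⟩ := Option.ne_none_iff_exists'.1 hi
    have := h (i, s) hs
    rw [unitForm_apply] at this
    cases s <;> simpa using this
  · intro h p hp
    have hp : σ p.1 = some p.2 := hp
    rw [unitForm_apply, h p.1 (by simp [hp]), mul_zero]

/-- The linear form of the `i`-th inequality of a deformed cube with the given sign. -/
noncomputable def rowForm (m : ℕ) (ε : ℝ) (p : Fin m × Bool) : StrongDual ℝ (Fin m → ℝ) :=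
  LinearMap.toContinuousLinearMap
    ((LinearMap.proj p.1).comp (bandMatrix m (if p.2 then ε else -ε)).mulVecLin)

theorem rowForm_eq_mulVec (ε : ℝ) (p : Fin m × Bool) (x : Fin m → ℝ) :
    rowForm m ε p x = (bandMatrix m (if p.2 then ε else -ε)).mulVec x p.1 := rfl

theorem rowForm_apply (ε : ℝ) (p : Fin m × Bool) (x : Fin m → ℝ) :
    rowForm m ε p x = (if p.2 then ε else -ε) * x p.1 + bandTail x p.1 := by
  rw [rowForm_eq_mulVec, bandMatrix_mulVec]

variable {ε : ℝ} {b : Fin m → ℝ}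

theorem deformedFace_eq_tightFace (σ : CubePattern m) :
    deformedFace ε b σ = tightFace (rowForm m ε) (fun p => b p.1) (fixedSet σ) := by
  ext x
  simp only [deformedFace, deformedCube, tightFace, fixedSet, rowForm_eq_mulVec, Prod.forall,
    Set.mem_ofPred_eq]
  refine and_congr_left fun _ => forall_congr' fun i => ?_
  simp [and_comm]

theorem deformedCube_eq_tightFace :
    deformedCube m ε b = tightFace (rowForm m ε) (fun p => b p.1) ∅ := by
  ext x
  simp [deformedCube, tightFace, rowForm_eq_mulVec, and_comm]

theorem isFaceOf_deformedFace {σ : CubePattern m} (hne : (deformedFace ε b σ).Nonempty) :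
    IsFaceOf (deformedCube m ε b) (deformedFace ε b σ) := by
  rw [deformedFace_eq_tightFace] at hne ⊢
  rw [deformedCube_eq_tightFace]
  exact ⟨hne, isExposed_tightFace (Set.empty_subset _)⟩

/-! ### Existence of deformed cubes -/

theorem abs_bandTail_le (x : Fin m → ℝ) (i : ℕ) :
    |bandTail x i| ≤ 2 * |padded x (i + 3)| + 7 * |padded x (i + 2)| + 7 * |padded x (i + 1)| +
      2 * |padded x i| := by
  unfold bandTail
  rw [abs_le]
  constructor <;>
  linarith [neg_abs_le (padded x (i + 3)), neg_abs_le (padded x (i + 2)),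
    neg_abs_le (padded x (i + 1)), neg_abs_le (padded x i), le_abs_self (padded x (i + 3)),
    le_abs_self (padded x (i + 2)), le_abs_self (padded x (i + 1)), le_abs_self (padded x i)]

/-- If `ε |x i| ≤ |q ^ i - bandTail x i|` for all `i`, where `q = 6 / ε ≥ 9`, then the coordinate `x i`
is at most `q ^ (i + 1) / 3` in absolute value. Absolute values on both sides make the bound available
before it is known that the differences on the right are positive. -/
theorem abs_padded_mul_le {q : ℝ} (hq : 9 ≤ q) (hqε : q * ε = 6) {x : Fin m → ℝ}
    (hx : ∀ i, ε * |x i| ≤ |q ^ i.val - bandTail x i|) (n : ℕ) :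
    |padded x n| * q ^ 3 ≤ q ^ n / 3 := by
  have hq0 : 0 < q := by linarith
  induction n using Nat.strong_induction_on with
  | _ n ih =>
    by_cases hn : 4 ≤ n ∧ n < m + 4
    · obtain ⟨i, rfl⟩ : ∃ i : Fin m, n = i.val + 4 := ⟨⟨n - 4, by omega⟩, by simp only; omega⟩
      have htail : |bandTail x i| * q ^ 3 ≤ q ^ i.val * q ^ 3 := by
        have h0 := ih i (by omega)
        have h1 := ih (i + 1) (by omega)
        have h2 := ih (i + 2) (by omega)
        have h3 := ih (i + 3) (by omega)
        have habs := abs_bandTail_le x i.val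
        have hcubic : 2 * q ^ 3 + 7 * q ^ 2 + 7 * q + 2 ≤ 3 * q ^ 3 := by nlinarith
        have hmul := mul_le_mul_of_nonneg_right habs (pow_pos hq0 3).le
        have hmul' := mul_le_mul_of_nonneg_left hcubic (pow_pos hq0 i.val).le
        simp only [pow_add, pow_one] at h1 h2 h3
        linarith
      have htail' := le_of_mul_le_mul_right htail (pow_pos hq0 3)
      have habs : |q ^ i.val - bandTail x i| ≤ 2 * q ^ i.val := by
        refine (abs_sub _ _).trans ?_
        rw [abs_of_pos (pow_pos hq0 _)]
        linarith
      have hxi := mul_le_mul_of_nonneg_left ((hx i).trans habs) hq0.le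
      rw [← mul_assoc, hqε] at hxi
      rw [padded_add_four, pow_add]
      have := mul_le_mul_of_nonneg_right hxi (pow_pos hq0 3).le
      linarith
    · rw [padded, dif_neg hn, abs_zero, zero_mul]
      positivity

/-- The part of each inequality below the diagonal stays below the right-hand side, so that the
interval left for the coordinate on the diagonal has positive length. -/
theorem abs_bandTail_lt {q : ℝ} (hq : 9 ≤ q) (hqε : q * ε = 6) {x : Fin m → ℝ}
    (hx : ∀ i, ε * |x i| ≤ |q ^ i.val - bandTail x i|) (i : ℕ) : |bandTail x i| < q ^ i := by
  have hq0 : 0 < q := by linarith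
  have h0 := abs_padded_mul_le hq hqε hx i
  have h1 := abs_padded_mul_le hq hqε hx (i + 1)
  have h2 := abs_padded_mul_le hq hqε hx (i + 2)
  have h3 := abs_padded_mul_le hq hqε hx (i + 3)
  have habs := abs_bandTail_le x i
  have hcubic : 2 * q ^ 3 + 7 * q ^ 2 + 7 * q + 2 < 3 * q ^ 3 := by nlinarith
  have hmul := mul_le_mul_of_nonneg_right habs (pow_pos hq0 3).le
  have hmul' := mul_lt_mul_of_pos_left hcubic (pow_pos hq0 i)
  simp only [pow_add, pow_one] at h1 h2 h3
  refine lt_of_mul_lt_mul_right ?_ (pow_pos hq0 3).le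
  linarith

theorem mem_deformedCube_iff {x : Fin m → ℝ} (hε : 0 < ε) :
    x ∈ deformedCube m ε b ↔ ∀ i, ε * |x i| ≤ b i - bandTail x i := by
  simp only [deformedCube, Set.mem_ofPred_eq, bandMatrix_mulVec]
  refine forall_congr' fun i => ?_
  rw [← abs_of_pos hε, ← abs_mul, abs_le, abs_of_pos hε]
  constructor
  · rintro ⟨h1, h2⟩
    constructor <;> linarith
  · rintro ⟨h1, h2⟩
    constructor <;> linarith

theorem isClosed_deformedCube : IsClosed (deformedCube m ε b) := by
  rw [deformedCube_eq_tightFace]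
  simp only [tightFace, Set.ofPred_and, Set.ofPred_forall]
  refine IsClosed.inter (isClosed_iInter fun p => ?_)
    (isClosed_iInter fun p => isClosed_iInter fun _ => ?_)
  · exact isClosed_le (rowForm m ε p).continuous continuous_const
  · exact isClosed_eq (rowForm m ε p).continuous continuous_const

/-- For rapidly growing right-hand sides the deformed cube arises from intervals of positive length
over intervals of positive length, so that each coordinate can be put independently at either end or
in the interior of its interval. -/
theorem isCombinatorialCube_pow {q : ℝ} (hq : 9 ≤ q) (hqε : q * ε = 6) (hε : 0 < ε) :
    IsCombinatorialCube m ε (fun k => q ^ k.val) := by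
  have hq0 : 0 < q := by linarith
  have hmem : ∀ {x : Fin m → ℝ}, x ∈ deformedCube m ε (fun k => q ^ k.val) →
      ∀ i, ε * |x i| ≤ |q ^ i.val - bandTail x i| := fun hx i =>
    ((mem_deformedCube_iff hε).1 hx i).trans (le_abs_self _)
  have hgeneric : ∀ σ : CubePattern m, ∃ x ∈ deformedFace ε (fun k => q ^ k.val) σ,
      ∀ p ∉ fixedSet σ, rowForm m ε p x < q ^ p.1.val := by
    intro σ
    -- `y i` is the relative position of `ε * x i` in its interval, scaled to `[-1, 1]`
    let y : Fin m → ℝ := fun i => (σ i).elim 0 fun s => if s then 1 else -1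
    have hy : ∀ i, |y i| ≤ 1 := fun i => by
      simp only [y]
      rcases σ i with _ | _ | _ <;> simp
    obtain ⟨e, he⟩ := bijective_diag_add_bandTail (fun _ => ε) y fun _ => hε.ne'
    obtain ⟨x, hx⟩ := e.surjective fun i => y i * q ^ i.val
    have hxi : ∀ i, ε * x i = y i * (q ^ i.val - bandTail x i) := fun i => by
      have := he x i
      rw [hx] at this
      linarith
    have hpos : ∀ i : Fin m, 0 < q ^ i.val - bandTail x i := fun i => by
      have hle : ∀ i, ε * |x i| ≤ |q ^ i.val - bandTail x i| := fun i => by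
        rw [← abs_of_pos hε, ← abs_mul, hxi, abs_mul]
        exact mul_le_of_le_one_left (abs_nonneg _) (hy i)
      linarith [le_abs_self (bandTail x i), abs_bandTail_lt hq hqε hle i]
    have hrow : ∀ p, rowForm m ε p x =
        q ^ p.1.val - (1 - (if p.2 then 1 else -1) * y p.1) * (q ^ p.1.val - bandTail x p.1) := by
      intro p
      rw [rowForm_apply]
      rcases p with ⟨i, _ | _⟩ <;> simp <;> linarith [hxi i]
    refine ⟨x, ?_, fun p hp => ?_⟩
    · rw [deformedFace_eq_tightFace]
      refine ⟨fun p => ?_, fun p hp => ?_⟩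
      · have hle : (if p.2 then (1 : ℝ) else -1) * y p.1 ≤ 1 := by
          split_ifs <;> linarith [(abs_le.1 (hy p.1)).1, (abs_le.1 (hy p.1)).2]
        rw [hrow]
        linarith [mul_nonneg (sub_nonneg.2 hle) (hpos p.1).le]
      · have hp : σ p.1 = some p.2 := hp
        have h1 : (if p.2 then (1 : ℝ) else -1) * y p.1 = 1 := by
          simp only [y, hp]
          cases p.2 <;> simp
        rw [hrow, h1]
        ring
    · have hp : σ p.1 ≠ some p.2 := hp
      have hlt : (if p.2 then (1 : ℝ) else -1) * y p.1 < 1 := by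
        revert hp
        simp only [y]
        rcases σ p.1 with _ | _ | _ <;> rcases p.2 with _ | _ <;> norm_num
      rw [hrow]
      linarith [mul_pos (sub_pos.2 hlt) (hpos p.1)]
  have hsubset : ∀ σ τ : CubePattern m, deformedFace ε (fun k => q ^ k.val) σ ⊆
      deformedFace ε (fun k => q ^ k.val) τ ↔ cubeFace σ ⊆ cubeFace τ := by
    intro σ τ
    rw [cubeFace_subset_iff]
    constructor
    · intro h p hp
      obtain ⟨x, hx, hlt⟩ := hgeneric σ
      by_contra hpσ
      have hxτ := h hx
      rw [deformedFace_eq_tightFace] at hxτ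
      exact (hlt p hpσ).ne (hxτ.2 p hp)
    · intro h
      rw [deformedFace_eq_tightFace, deformedFace_eq_tightFace]
      exact tightFace_anti h
  refine ⟨?_, ⟨fun σ _ => ?_, fun σ _ τ _ h => ?_, fun G hG => ?_⟩, hsubset⟩
  · have hcomp : IsCompact (deformedCube m ε fun k => q ^ k.val) := by
      refine (isCompact_univ_pi fun i : Fin m =>
        isCompact_Icc (a := -(2 * q ^ i.val / ε)) (b := 2 * q ^ i.val / ε)).of_isClosed_subset
        isClosed_deformedCube fun x hx i _ => ?_
      rw [Set.mem_Icc, ← abs_le, le_div_iff₀ hε, mul_comm]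
      have h1 := (mem_deformedCube_iff hε).1 hx i
      have h2 := (abs_lt.1 (abs_bandTail_lt hq hqε (hmem hx) i)).1
      linarith
    rw [deformedCube_eq_tightFace] at hcomp ⊢
    exact hcomp.isPolytope_of_finite_extremePoints convex_tightFace finite_extremePoints_tightFace
  · obtain ⟨x, hx, -⟩ := hgeneric σ
    exact isFaceOf_deformedFace ⟨x, hx⟩
  · exact cubeFace_injective
      (Set.Subset.antisymm ((hsubset σ τ).1 h.le) ((hsubset τ σ).1 h.ge))
  · have hG : IsFaceOf _ G := hG
    rw [deformedCube_eq_tightFace] at hG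
    obtain ⟨K, -, rfl⟩ := hG.exists_eq_tightFace
    obtain ⟨x, hx⟩ := hG.1
    have hxP : x ∈ deformedCube m ε (fun k => q ^ k.val) := by
      rw [deformedCube_eq_tightFace]
      exact tightFace_anti (Set.empty_subset K) hx
    -- two opposite inequalities are never tight at the same time
    have hK : ∀ i, (i, true) ∈ K → (i, false) ∉ K := by
      intro i h1 h2
      have h3 := hx.2 _ h1
      have h4 := hx.2 _ h2
      have h5 := (abs_lt.1 (abs_bandTail_lt hq hqε (hmem hxP) i)).2
      simp only [rowForm_apply, if_true, Bool.false_eq_true, if_false] at h3 h4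
      linarith
    classical
    refine ⟨fun i => if (i, true) ∈ K then some true else if (i, false) ∈ K then some false else none,
      Set.mem_univ _, ?_⟩
    rw [deformedFace_eq_tightFace]
    congr 1
    ext ⟨i, s⟩
    have := hK i
    rcases s with _ | _ <;> by_cases h1 : (i, true) ∈ K <;> by_cases h2 : (i, false) ∈ K <;>
      simp_all [fixedSet]

end Patterns

/-! ### The surface in a deformed cube -/

section Surface

variable {m : ℕ} {ε : ℝ} {b : Fin m → ℝ}

theorem IsCombinatorialCube.isFaceOf (h : IsCombinatorialCube m ε b) (σ : CubePattern m) :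
    IsFaceOf (deformedCube m ε b) (deformedFace ε b σ) :=
  h.bijOn.mapsTo (Set.mem_univ σ)

/-- Each face of a deformed cube contains a point at which no further inequality is tight: otherwise
it would be contained in another facet. -/
theorem IsCombinatorialCube.exists_mem_deformedFace_forall_lt (h : IsCombinatorialCube m ε b)
    (σ : CubePattern m) :
    ∃ x ∈ deformedFace ε b σ, ∀ p ∉ fixedSet σ, rowForm m ε p x < b p.1 := by
  have hface := h.isFaceOf σ
  have hP : ∀ x ∈ deformedFace ε b σ, ∀ p, rowForm m ε p x ≤ b p.1 := fun x hx p => by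
    rw [deformedFace_eq_tightFace] at hx
    exact hx.1 p
  obtain ⟨x, hx, hlt⟩ := exists_mem_forall_lt (f := rowForm m ε) (b := fun p => b p.1)
    (hface.2.convex h.polytope.convex) hface.1 hP
  refine ⟨x, hx, fun p hp => hlt p ?_⟩
  by_contra! htight
  let τ : CubePattern m := fun i => if i = p.1 then some p.2 else none
  have hτ : deformedFace ε b σ ⊆ deformedFace ε b τ := by
    intro y hy
    rw [deformedFace_eq_tightFace]
    refine ⟨hP y hy, fun q hq => ?_⟩
    have hq : τ q.1 = some q.2 := hq
    have hqp : q = p := by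
      simp only [τ] at hq
      split_ifs at hq with h1
      exact Prod.ext h1 (by simpa using hq.symm)
    rw [hqp]
    exact le_antisymm (hP y hy p) (htight y hy)
  exact hp (cubeFace_subset_iff.1 ((h.subset_iff σ τ).1 hτ) (by simp [fixedSet, τ]))

theorem IsCombinatorialCube.mem_vectorSpan_deformedFace (h : IsCombinatorialCube m ε b)
    (σ : CubePattern m) (z : Fin m → ℝ) :
    z ∈ vectorSpan ℝ (deformedFace ε b σ) ↔ ∀ p ∈ fixedSet σ, rowForm m ε p z = 0 := by
  obtain ⟨x, hx, hlt⟩ := h.exists_mem_deformedFace_forall_lt σ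
  rw [deformedFace_eq_tightFace] at hx ⊢
  exact mem_vectorSpan_tightFace hx hlt z

theorem IsCombinatorialCube.polyDim_deformedFace (h : IsCombinatorialCube m ε b) (hε : ε ≠ 0)
    (σ : CubePattern m) : polyDim (deformedFace ε b σ) = polyDim (cubeFace σ) := by
  obtain ⟨e, he⟩ := bijective_diag_add_bandTail
    (fun i => if σ i = some true then ε else -ε) (fun _ => 1) fun i => by split_ifs <;> simpa
  have hmap : (vectorSpan ℝ (deformedFace ε b σ)).map (e : (Fin m → ℝ) →ₗ[ℝ] (Fin m → ℝ)) =
      vectorSpan ℝ (cubeFace σ) := by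
    ext w
    rw [Submodule.mem_map_equiv, h.mem_vectorSpan_deformedFace, mem_vectorSpan_cubeFace]
    have hw : ∀ i, w i = (if σ i = some true then ε else -ε) * e.symm w i +
        bandTail (e.symm w) i := fun i => by
      rw [← one_mul (bandTail _ _), ← he, e.apply_symm_apply]
    constructor
    · intro hz i hi
      obtain ⟨s, hs⟩ := Option.ne_none_iff_exists'.1 hi
      rw [hw, ← hz (i, s) hs, rowForm_apply]
      simp [hs]
    · rintro hz ⟨i, s⟩ hs
      have hs : σ i = some s := hs
      rw [rowForm_apply, ← hz i (by simp [hs]), hw]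
      simp [hs]
  rw [polyDim, polyDim, ← hmap, LinearEquiv.finrank_map_eq]

theorem IsCombinatorialCube.isPolyhedralComplex_deformedSurface (h : IsCombinatorialCube m ε b) :
    IsPolyhedralComplex (deformedSurface m ε b) := by
  have hmem : ∀ σ ∈ surfacePatterns m, ∀ H, IsFaceOf (deformedFace ε b σ) H →
      H ∈ deformedSurface m ε b := by
    intro σ hσ H hH
    rw [deformedFace_eq_tightFace] at hH
    obtain ⟨K, hK, hHK⟩ := hH.exists_eq_tightFace
    have hHP : IsFaceOf (deformedCube m ε b) H := by
      refine ⟨hH.1, ?_⟩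
      rw [deformedCube_eq_tightFace, hHK]
      exact isExposed_tightFace (Set.empty_subset K)
    obtain ⟨τ, -, hτ⟩ := h.bijOn.surjOn hHP
    refine ⟨τ, mem_surfacePatterns_of_fixedSet_subset hσ (cubeFace_subset_iff.1
      ((h.subset_iff τ σ).1 ?_)), hτ⟩
    rw [hτ, hHK, deformedFace_eq_tightFace]
    exact tightFace_anti hK
  refine ⟨(Set.toFinite _).image _, ?_, ?_, ?_, ?_⟩
  · rintro _ ⟨σ, -, rfl⟩
    exact (h.isFaceOf σ).1
  · rintro _ ⟨σ, -, rfl⟩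
    exact h.polytope.of_isFaceOf (h.isFaceOf σ)
  · rintro _ ⟨σ, hσ, rfl⟩ H hH
    exact hmem σ hσ H hH
  · rintro _ ⟨σ, -, rfl⟩ _ ⟨τ, -, rfl⟩ hne
    have hexp := (h.isFaceOf σ).2.inter (h.isFaceOf τ).2
    exact ⟨⟨hne, hexp.mono (h.isFaceOf σ).2.subset Set.inter_subset_left⟩,
      ⟨hne, hexp.mono (h.isFaceOf τ).2.subset Set.inter_subset_right⟩⟩

/-! ### The projection to the last four coordinates -/

theorem eq_zero_of_lastFour_eq_zero {hm : 4 ≤ m} {x : Fin m → ℝ} (hx : lastFour m hm x = 0)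
    (j : Fin m) (hj : m ≤ j.val + 4) : x j = 0 := by
  have := congrFun hx ⟨j.val + 4 - m, by omega⟩
  rw [lastFour, LinearMap.funLeft_apply, Pi.zero_apply] at this
  convert this using 2
  ext
  simp only
  omega

theorem lastFour_surjective (hm : 4 ≤ m) : Function.Surjective (lastFour m hm) :=
  LinearMap.funLeft_surjective_of_injective _ _ _ fun i j hij => by
    have := congrArg Fin.val hij
    simp only at this
    exact Fin.ext (by omega)

theorem disjoint_vectorSpan_ker_lastFour (hm : 4 ≤ m) (h : IsCombinatorialCube m ε b) (hε : 0 < ε)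
    (hε' : 8 ^ m * ε < 1) {σ : CubePattern m} (hσ : σ ∈ surfacePatterns m) :
    Disjoint (vectorSpan ℝ (deformedFace ε b σ)) (LinearMap.ker (lastFour m hm)) := by
  rw [Submodule.disjoint_def]
  intro z hz hker
  rw [h.mem_vectorSpan_deformedFace] at hz
  obtain ⟨t, ht⟩ := hσ
  refine eq_zero_of_rows_eq_zero hε hε' (d := fun i => if σ i = some true then ε else -ε) (t := t)
    (fun i => ?_) (eq_zero_of_lastFour_eq_zero hker) fun i h1 h2 => ?_
  · split_ifs <;> simp [abs_of_pos hε]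
  · obtain ⟨s, hs⟩ := Option.ne_none_iff_exists'.1 fun hi => (ht i hi).elim h1 h2
    have := hz (i, s) hs
    rw [rowForm_apply] at this
    simpa [hs] using this

/-- Of the pairs of successive positions that contain all free positions of a surface pattern, at least
one misses a given fixed position. -/
theorem exists_pair_not_mem (hm : 4 ≤ m) {σ : CubePattern m} (hσ : σ ∈ surfacePatterns m) {k : Fin m}
    (hk : σ k ≠ none) :
    ∃ t : Fin m, (∀ i, σ i = none → i = t ∨ i.val = (t.val + 1) % m) ∧
      k ≠ t ∧ k.val ≠ (t.val + 1) % m := by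
  obtain ⟨t, ht⟩ := hσ
  have htm := t.isLt
  have hmod := succ_mod_eq_ite htm
  have hlt : (t.val + 1) % m < m := Nat.mod_lt _ (by omega)
  by_cases h1 : k = t
  · refine ⟨⟨(t.val + 1) % m, hlt⟩, fun i hi => ?_, ?_, ?_⟩
    · rcases ht i hi with h | h
      · exact absurd (h1 ▸ h ▸ hi) hk
      · exact Or.inl (Fin.ext h)
    · rw [h1, Ne, Fin.ext_iff]
      simp only [hmod]
      split_ifs <;> omega
    · rw [h1, succ_mod_eq_ite hlt]
      split_ifs at hmod ⊢ <;> omega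
  by_cases h2 : k.val = (t.val + 1) % m
  · have hprev : (t.val + m - 1) % m < m := Nat.mod_lt _ (by omega)
    have hval : (t.val + m - 1) % m = if t.val = 0 then m - 1 else t.val - 1 := by
      split_ifs with h0
      · rw [h0, Nat.mod_eq_of_lt (by omega)]
        omega
      · rw [show t.val + m - 1 = t.val - 1 + m by omega, Nat.add_mod_right,
          Nat.mod_eq_of_lt (by omega)]
    have hnext : ((t.val + m - 1) % m + 1) % m = t := by
      rw [succ_mod_eq_ite hprev, hval]
      split_ifs <;> omega
    refine ⟨⟨(t.val + m - 1) % m, hprev⟩, fun i hi => ?_, ?_, ?_⟩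
    · rcases ht i hi with h | h
      · right
        rw [hnext, h]
      · exact absurd ((Fin.ext (h.trans h2.symm) : i = k) ▸ hi) hk
    · rw [Ne, Fin.ext_iff]
      simp only [h2, hmod, hval]
      split_ifs <;> omega
    · rw [h2, hnext, hmod]
      split_ifs <;> omega
  · exact ⟨t, ht, h1, h2⟩

/-- The certificate for a surface pattern is the sum of the dependencies that vanish at a pair of
successive positions containing all free positions. -/
theorem exists_dependency (hm : 4 ≤ m) (hdet : ∀ (s : Fin m → Bool) (t k : Fin m), k ≠ t →
      k.val ≠ (t.val + 1) % m → 0 < dependencyDet (signedDiag s ε) t ((t.val + 1) % m) k)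
    {σ : CubePattern m} (hσ : σ ∈ surfacePatterns m) (s : Fin m → Bool) :
    ∃ c : ℕ → ℝ, (∀ n, signedDiag s ε n * c n + 2 * c (n + 1) - 7 * c (n + 2) + 7 * c (n + 3) -
        2 * c (n + 4) = 0) ∧ (∀ k : Fin m, σ k = none → c k = 0) ∧
      ∀ k : Fin m, σ k ≠ none → 0 < c k := by
  classical
  let T : Finset (Fin m) := {t | ∀ i, σ i = none → i = t ∨ i.val = (t.val + 1) % m}
  refine ⟨fun n => ∑ t ∈ T, dependencyDet (signedDiag s ε) t ((t.val + 1) % m) n, fun n => ?_,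
    fun k hk => ?_, fun k hk => ?_⟩
  · simp only [Finset.mul_sum, ← Finset.sum_add_distrib, ← Finset.sum_sub_distrib]
    exact Finset.sum_eq_zero fun t _ => dependencyDet_rec _ _ _ _
  · refine Finset.sum_eq_zero fun t ht => ?_
    rcases (Finset.mem_filter.1 ht).2 k hk with h | h
    · rw [h, dependencyDet_left]
    · rw [h, dependencyDet_right]
  · obtain ⟨t, ht, h1, h2⟩ := exists_pair_not_mem hm hσ hk
    refine Finset.sum_pos' (fun t' _ => ?_) ⟨t, by simpa [T] using ht, hdet s t k h1 h2⟩
    by_cases h1' : k = t'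
    · rw [h1', dependencyDet_left]
    by_cases h2' : k.val = (t'.val + 1) % m
    · rw [h2', dependencyDet_right]
    exact (hdet s t' k h1' h2').le

theorem strictlyPreserved_deformedFace (hm : 4 ≤ m) (h : IsCombinatorialCube m ε b) (hε : 0 < ε)
    (hε' : 8 ^ m * ε < 1) (hdet : ∀ (s : Fin m → Bool) (t k : Fin m), k ≠ t →
      k.val ≠ (t.val + 1) % m → 0 < dependencyDet (signedDiag s ε) t ((t.val + 1) % m) k)
    {σ : CubePattern m} (hσ : σ ∈ surfacePatterns m) :
    StrictlyPreserved (lastFour m hm) (deformedCube m ε b) (deformedFace ε b σ) := by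
  classical
  have hinj : Set.InjOn (lastFour m hm) (deformedFace ε b σ) := fun x hx y hy hxy => by
    refine sub_eq_zero.1 (Submodule.disjoint_def.1
      (disjoint_vectorSpan_ker_lastFour hm h hε hε' hσ) _ (vsub_mem_vectorSpan ℝ hx hy) ?_)
    rw [LinearMap.mem_ker, map_sub, hxy, sub_self]
  obtain ⟨c, hrec, hzero, hpos⟩ := exists_dependency hm hdet hσ fun i => decide (σ i = some true)
  let w : Fin m × Bool → ℝ := fun p => if σ p.1 = some p.2 then c p.1 else 0
  let L : StrongDual ℝ (Fin m → ℝ) := ∑ p, w p • rowForm m ε p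
  have hL : ∀ x, L x = ∑ p, w p * rowForm m ε p x := fun x => by
    simp [L, sum_apply]
  have hLker : ∀ x, lastFour m hm x = 0 → L x = 0 := by
    intro x hx
    rw [hL, Fintype.sum_prod_type, ← sum_mul_bandMatrix_mulVec_eq_zero hrec
      (eq_zero_of_lastFour_eq_zero hx)]
    refine Finset.sum_congr rfl fun i _ => ?_
    rw [signedDiag_val, Fintype.sum_bool]
    simp only [w, rowForm_eq_mulVec]
    rcases hi : σ i with _ | _ | _
    · simp [hzero i hi]
    · simp
    · simp
  obtain ⟨r, hr⟩ := (lastFour m hm).exists_rightInverse_of_surjective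
    (LinearMap.range_eq_top.2 (lastFour_surjective hm))
  have hg : ∀ x, L x = L (r (lastFour m hm x)) := fun x => by
    rw [← sub_eq_zero, ← map_sub]
    refine hLker _ ?_
    rw [map_sub, ← LinearMap.comp_apply, hr, LinearMap.id_apply, sub_self]
  have hne := (h.isFaceOf σ).1
  rw [deformedFace_eq_tightFace] at hinj hne ⊢
  rw [deformedCube_eq_tightFace]
  refine strictlyPreserved_tightFace hne w (fun p hp => ?_) (fun p hp => if_neg hp)
    (LinearMap.toContinuousLinearMap ((L : (Fin m → ℝ) →ₗ[ℝ] ℝ).comp r))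
    (fun x => (hL x).symm.trans (hg x)) hinj
  have hp : σ p.1 = some p.2 := hp
  simp only [w, hp, if_true]
  exact hpos p.1 (by simp [hp])

theorem exists_fixed_of_mem_surfacePatterns (hm : 4 ≤ m) {σ : CubePattern m}
    (hσ : σ ∈ surfacePatterns m) : ∃ i, σ i ≠ none := by
  by_contra! hall
  obtain ⟨t, ht⟩ := hσ
  have h0 := ht ⟨0, by omega⟩ (hall _)
  have h1 := ht ⟨1, by omega⟩ (hall _)
  have h2 := ht ⟨2, by omega⟩ (hall _)
  simp only [Fin.ext_iff] at h0 h1 h2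
  omega

theorem polyDim_lastFour_image (hm : 4 ≤ m) (h : IsCombinatorialCube m ε b) :
    polyDim (lastFour m hm '' deformedCube m ε b) = 4 := by
  have hcube : deformedCube m ε b = deformedFace ε b fun _ => none := by
    simp [deformedFace]
  have htop : vectorSpan ℝ (deformedCube m ε b) = ⊤ := by
    refine eq_top_iff.2 fun z _ => ?_
    rw [hcube, h.mem_vectorSpan_deformedFace]
    simp [fixedSet]
  have hmap : vectorSpan ℝ (lastFour m hm '' deformedCube m ε b) = ⊤ := by
    rw [← (LinearMap.range_eq_top.2 (lastFour_surjective hm)), ← Submodule.map_top, ← htop]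
    simpa using ((lastFour m hm).toAffineMap.map_vectorSpan (s := deformedCube m ε b)).symm
  rw [polyDim, hmap, finrank_top, Module.finrank_fin_fun]

/-- For patterns of the surface, the images of the faces of the deformed cube are ordered in the same
way as the faces of the standard cube. -/
theorem exists_orderIso_imageComplex {π : (Fin m → ℝ) →ₗ[ℝ] (Fin 4 → ℝ)}
    (h : IsCombinatorialCube m ε b) (hε : ε ≠ 0)
    (hπ : IsPolyhedralEmbedding π (deformedSurface m ε b)) :
    ∃ e : quadSurface m ≃o imageComplex π (deformedSurface m ε b),
      (∀ F : quadSurface m, polyDim (e F).1 = polyDim F.1) ∧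
      ∀ (F : quadSurface m) (σ : CubePattern m), F.1 = cubeFace σ →
        (e F).1 = π '' deformedFace ε b σ := by
  choose σ hσ hσF using fun F : quadSurface m => F.2
  have hmem : ∀ F, deformedFace ε b (σ F) ∈ deformedSurface m ε b := fun F => ⟨σ F, hσ F, rfl⟩
  let e : quadSurface m ↪o imageComplex π (deformedSurface m ε b) :=
    OrderEmbedding.ofMapLEIff (fun F => ⟨π '' deformedFace ε b (σ F), _, hmem F, rfl⟩)
      fun F G => by
        rw [← Subtype.coe_le_coe, ← Subtype.coe_le_coe]
        simp only
        rw [hπ.subset_iff _ (hmem F) _ (hmem G), h.subset_iff, hσF, hσF]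
  have he : ∀ (F : quadSurface m) (τ : CubePattern m), F.1 = cubeFace τ →
      (e F).1 = π '' deformedFace ε b τ := fun F τ hF => by
    rw [← cubeFace_injective ((hσF F).trans hF)]
    rfl
  have hsurj : Function.Surjective e := by
    rintro ⟨_, _, ⟨τ, hτ, rfl⟩, rfl⟩
    exact ⟨⟨cubeFace τ, τ, hτ, rfl⟩, Subtype.ext (he _ τ rfl)⟩
  refine ⟨RelIso.ofSurjective e hsurj, fun F => ?_, he⟩
  rw [← hσF F, ← h.polyDim_deformedFace hε]
  exact hπ.dim_eq _ (hmem F)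

end Surface

theorem mainTheorem2 (m : ℕ) (hm : 4 ≤ m) :
    ∃ ε₀ : ℝ, 0 < ε₀ ∧ ∀ ε : ℝ, 0 < ε → ε < ε₀ →
      IsCombinatorialCube m ε (fun k => (6 / ε) ^ k.val) ∧
      ∀ b : Fin m → ℝ, IsCombinatorialCube m ε b →
        -- the projection of the deformed cube is a polytope of dimension four
        IsPolytope (lastFour m hm '' deformedCube m ε b) ∧
        polyDim (lastFour m hm '' deformedCube m ε b) = 4 ∧
        -- all cells of the surface are strictly preserved
        (∀ G ∈ deformedSurface m ε b,
          StrictlyPreserved (lastFour m hm) (deformedCube m ε b) G) ∧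
        -- the surface is embedded, as part of the boundary complex of the projected polytope
        Set.InjOn (lastFour m hm) (⋃₀ deformedSurface m ε b) ∧
        IsPolyhedralEmbedding (lastFour m hm) (deformedSurface m ε b) ∧
        imageComplex (lastFour m hm) (deformedSurface m ε b) ⊆
          boundaryComplex (lastFour m hm '' deformedCube m ε b) ∧
        -- the embedded surface is a copy of the quad-surface in the standard cube
        ∃ e : quadSurface m ≃o imageComplex (lastFour m hm) (deformedSurface m ε b),
          (∀ F : quadSurface m, polyDim (e F).1 = polyDim F.1) ∧
          ∀ (F : quadSurface m) (σ : CubePattern m), F.1 = cubeFace σ →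
            (e F).1 = lastFour m hm '' deformedFace ε b σ := by
  obtain ⟨ε₁, hε₁, hdet⟩ := Metric.eventually_nhds_iff.1 (eventually_dependencyDet_pos m)
  refine ⟨min ε₁ (1 / 8 ^ m), lt_min hε₁ (by positivity), fun ε hε hlt => ?_⟩
  have hdet : ∀ (s : Fin m → Bool) (t k : Fin m), k ≠ t → k.val ≠ (t.val + 1) % m →
      0 < dependencyDet (signedDiag s ε) t ((t.val + 1) % m) k := by
    refine hdet ?_
    rw [Real.dist_eq, sub_zero, abs_of_pos hε]
    exact hlt.trans_le (min_le_left _ _)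
  have hε' : 8 ^ m * ε < 1 := by
    rw [mul_comm, ← lt_div_iff₀ (by positivity)]
    exact hlt.trans_le (min_le_right _ _)
  have hq : 9 ≤ 6 / ε := by
    have h8 : (8 : ℝ) ^ 1 ≤ 8 ^ m := pow_le_pow_right₀ (by norm_num) (by omega)
    rw [le_div_iff₀ hε]
    nlinarith
  refine ⟨isCombinatorialCube_pow hq (div_mul_cancel₀ 6 hε.ne') hε, fun b h => ?_⟩
  have hpres : ∀ G ∈ deformedSurface m ε b,
      StrictlyPreserved (lastFour m hm) (deformedCube m ε b) G := by
    rintro _ ⟨σ, hσ, rfl⟩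
    exact strictlyPreserved_deformedFace hm h hε hε' hdet hσ
  have hemb : IsPolyhedralEmbedding (lastFour m hm) (deformedSurface m ε b) := by
    refine isPolyhedralEmbedding_of_strictlyPreserved (lastFour m hm).continuous_of_finiteDimensional
      h.isPolyhedralComplex_deformedSurface hpres ?_
    rintro _ ⟨σ, hσ, rfl⟩
    exact disjoint_vectorSpan_ker_lastFour hm h hε hε' hσ
  refine ⟨h.polytope.image _, polyDim_lastFour_image hm h, hpres,
    injOn_sUnion_of_strictlyPreserved hpres, hemb, ?_, exists_orderIso_imageComplex h hε.ne' hemb⟩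
  rintro _ ⟨_, ⟨σ, hσ, rfl⟩, rfl⟩
  obtain ⟨-, hface, hpre, -⟩ := hpres _ ⟨σ, hσ, rfl⟩
  refine ⟨hface, fun heq => ?_⟩
  -- a cell with the whole polytope as image would be the whole deformed cube
  have hall : deformedFace ε b σ = deformedFace ε b fun _ => none := by
    rw [← hpre]
    simp only at heq
    rw [heq, Set.inter_eq_left.2 (Set.subset_preimage_image _ _)]
    simp [deformedFace]
  obtain ⟨i, hi⟩ := exists_fixed_of_mem_surfacePatterns hm hσ
  exact hi (congrFun (h.bijOn.injOn (Set.mem_univ _) (Set.mem_univ _) hall) i)
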